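/- Let \(A\) be an associative unital ring (not necessarily commutative) whose additive group is free of finite rank, and regard \(A\) as a subring of \(\mathbb{Q}A=\mathbb{Q}\otimes_{\mathbb{Z}}A\). For every prime \(p\) let \(a_p\) be a random non-zero element of \(A\) and \(c_p\) a random integer such that all the random variables \(a_p, c_p\) (\(p\) prime) are independent, each \(c_p\) is uniformly distributed on the integers in \([p,2p-1]\), and for every non-zero \(a\in A\) there is \(\delta_a>0\) with \(\mathbb{P}(a_p=a)\ge\delta_a\) for all primes \(p\) (for instance, the \(a_p\) are identically distributed and take every non-zero value with positive probability). Then almost surely the following holds. Whenever, for every prime \(p\) such that \(c_p-a_p\) is invertible in \(\mathbb{Q}A\), a positive integer \(r_p\) is chosen such that \(p^{r_p}d_p(c_p-a_p)^{-1}\in A\) for some positive integer \(d_p\) relatively prime to \(p\), the abelian group \[ M=\bigl\langle A,\; p^{-r_p}(c_p-a_p)A \;:\; p \text{ prime and } c_p-a_p \text{ invertible in } \mathbb{Q}A\bigr\rangle\subseteq\mathbb{Q}A \] satisfies \(\operatorname{End} M=A\), where \(A\) acts on \(M\) by multiplication on the right. That is, \(M\) is stable under right multiplication by elements of \(A\),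 and sending \(a\in A\) to the map \(m\mapsto ma\) is a bijection from \(A\) onto the set of all endomorphisms of the abelian group \(M\), and a ring isomorphism when endomorphisms are written on the right of their arguments. -/

import Mathlib

open MeasureTheory ProbabilityTheory
open scoped TensorProduct ENNReal

/-- The canonical ring homomorphism from `A` to `ℚA = ℚ ⊗ A`, sending `x` to `1 ⊗ x`.  It is
injective when the additive group of `A` is free; `A` is then identified with its range. -/
noncomputable def toQ (A : Type*) [Ring A] : A →+* ℚ ⊗[ℤ] A :=
  (Algebra.TensorProduct.includeRight : A →ₐ[ℤ] ℚ ⊗[ℤ] A).toRingHom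

/-- `c_p - a_p` is invertible in `ℚA`. -/
def InvertibleAt {A : Type*} [Ring A] (a : Nat.Primes → A) (c : Nat.Primes → ℤ)
    (p : Nat.Primes) : Prop :=
  IsUnit (toQ A ((c p : A) - a p))

/-- The exponents `r_p` are admissible: whenever `c_p - a_p` is invertible in `ℚA`, the integer
`r_p` is positive and there is a positive integer `d_p` prime to `p` such that
`p ^ r_p * d_p * (c_p - a_p)⁻¹` lies in `A`. -/
def AdmissibleExponents {A : Type*} [Ring A] (a : Nat.Primes → A) (c : Nat.Primes → ℤ)
    (r : Nat.Primes → ℕ) : Prop :=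
  ∀ p : Nat.Primes, InvertibleAt a c p →
    0 < r p ∧ ∃ d : ℕ, 0 < d ∧ Nat.Coprime d (p : ℕ) ∧
      (((p : ℕ) : ℚ) ^ r p * (d : ℚ)) • Ring.inverse (toQ A ((c p : A) - a p)) ∈
        (toQ A).range

/-- The subgroup of `ℚA` generated by `A` and the sets `p ^ (-r_p) (c_p - a_p) A`, for all primes
`p` such that `c_p - a_p` is invertible in `ℚA`. -/
noncomputable def zassenhausGroup {A : Type*} [Ring A] (a : Nat.Primes → A)
    (c : Nat.Primes → ℤ) (r : Nat.Primes → ℕ) : AddSubgroup (ℚ ⊗[ℤ] A) :=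
  AddSubgroup.closure
    (Set.range (toQ A) ∪
      {x | ∃ p : Nat.Primes, InvertibleAt a c p ∧
        ∃ b : A, x = (((p : ℕ) : ℚ) ^ r p)⁻¹ • toQ A (((c p : A) - a p) * b)})

/-- `End M = A`, where `A` acts by right multiplication: `M` is stable under right multiplication
by the elements of `A`, and this action is an isomorphism of `A` with the ring of all endomorphisms
of the abelian group `M`.  The opposite ring of `A` appears because endomorphisms are composed here
as functions written on the left. -/
def EndIsRightMul {A : Type*} [Ring A] (M : AddSubgroup (ℚ ⊗[ℤ] A)) : Prop :=
  ∃ φ : Aᵐᵒᵖ ≃+* AddMonoid.End M,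
    ∀ (x : A) (m : M), ((φ (MulOpposite.op x) m : M) : ℚ ⊗[ℤ] A) = (m : ℚ ⊗[ℤ] A) * toQ A x

/-- The distribution of the random elements `a_p` of `A` and the random integers `c_p`.
All of them are independent (the pairs `(a_p, c_p)` are independent, and so are the two entries of
each pair), `c_p` is uniformly distributed on the integers in `[p, 2p - 1]`, and `a_p` is
non-zero.  As there is no uniform distribution on an infinite countable set, the choice of `a_p` is
only asked to take each fixed non-zero value with a probability bounded away from `0`, uniformly
in `p`; for instance the `a_p` may be identically distributed with full support `A \ {0}`. -/
structure ZassenhausDistribution {Ω : Type*} [MeasurableSpace Ω] {A : Type*} [Ring A]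
    [MeasurableSpace A] (μ : Measure Ω) (a : Nat.Primes → Ω → A) (c : Nat.Primes → Ω → ℤ) :
    Prop where
  measurable_a : ∀ p, Measurable (a p)
  measurable_c : ∀ p, Measurable (c p)
  indep_pairs : iIndepFun (fun (p : Nat.Primes) (ω : Ω) => (a p ω, c p ω)) μ
  indep_entries : ∀ p, IndepFun (a p) (c p) μ
  uniform_c : ∀ p : Nat.Primes,
    μ.map (c p) = uniformOn (Set.Icc ((p : ℕ) : ℤ) (2 * ((p : ℕ) : ℤ) - 1))
  a_ne_zero : ∀ p, ∀ᵐ ω ∂μ, a p ω ≠ 0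
  a_charges : ∀ x : A, x ≠ 0 → ∃ δ : ℝ≥0∞, 0 < δ ∧ ∀ p, δ ≤ μ {ω | a p ω = x}

/-! Let φ be an endomorphism of M and z = φ(1). The main point is that φ(x) = xz for every x ∈ A. If
a_p = x and c_p − x is invertible, then φ sends p^(-r_p)(c_p − x) into M, and p-locally p^(r_p) M ⊆
(c_p − x)A by admissibility. As c_p z − φ(x) = (c_p − x)z + (xz − φ(x)), it follows that p-locally,
after clearing a denominator independent of p, c_p − x divides y = xz − φ(x) on the left. If y ≠ 0,
`exists_polynomial_obstruction` yields a nonconstant f ∈ ℤ[X] for which this fails at every large p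
dividing f(c_p).

Such p with a_p = x do occur. The primes modulo which f has a root have divergent reciprocal sum
(`not_summable_inv_primes_with_root`), each gives an event of probability at least δ_x/p, and the
second Borel–Cantelli lemma applies, simultaneously for the countably many pairs (x, f).

Once φ is right multiplication by z, comparing M with A locally at each p gives z ∈ A
(`mem_range_toQ_of_mul_mem`). -/

/-! ### The polynomial obstruction to divisibility by `c - a`. -/

/-- In a finitely generated abelian group, an element no nonzero multiple of which lies in a
subgroup `W` is detected by an integer-valued functional vanishing on `W`. -/
theorem exists_dual_vanishing_of_forall_smul_notMem {A : Type*} [AddCommGroup A] [Module.Finite ℤ A]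
    (W : Submodule ℤ A) (v : A) (hv : ∀ n : ℤ, n ≠ 0 → n • v ∉ W) :
    ∃ l : A →ₗ[ℤ] ℤ, (∀ w ∈ W, l w = 0) ∧ l v ≠ 0 := by
  let T := Submodule.torsion ℤ (A ⧸ W)
  have hne : T.mkQ (W.mkQ v) ≠ 0 := by
    intro h0
    rw [Submodule.mkQ_apply, Submodule.Quotient.mk_eq_zero] at h0
    obtain ⟨⟨n, hn⟩, h1⟩ := (Submodule.mem_torsion_iff _).1 h0
    refine hv n (nonZeroDivisors.ne_zero hn) ?_
    have h2 : n • W.mkQ v = 0 := h1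
    rw [← map_smul, Submodule.mkQ_apply, Submodule.Quotient.mk_eq_zero] at h2
    exact h2
  have : Module.Free ℤ ((A ⧸ W) ⧸ T) := Module.free_of_finite_type_torsion_free'
  by_contra! hcon
  refine hne ((Module.forall_dual_apply_eq_zero_iff ℤ _).1 fun g => ?_)
  refine hcon ((g.comp T.mkQ).comp W.mkQ) fun w hw => ?_
  simp [(Submodule.Quotient.mk_eq_zero W).2 hw]

open Polynomial in
theorem commute_aeval_self {A : Type*} [Ring A] (a : A) (f : ℤ[X]) : Commute a (aeval a f) := by
  have h : aeval a (X * f) = aeval a (f * X) := by rw [mul_comm]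
  simpa [Commute, SemiconjBy] using h

open Polynomial in
/-- For nonzero `y`, there is a nonconstant integer polynomial `f` such that `y` is not divisible
by `c - a` locally at `p`, for all but finitely many primes `p` and all integers `c` that are roots
of `f` modulo `p`. -/
theorem exists_polynomial_obstruction {A : Type*} [Ring A] [Module.Free ℤ A] [Module.Finite ℤ A]
    (a y : A) (hy : y ≠ 0) :
    ∃ f : ℤ[X], 0 < f.natDegree ∧ ∃ N : ℤ, N ≠ 0 ∧ ∀ (p k c : ℤ) (z : A),
      (∀ v : A, ((c : A) - a) * v = 0 → v = 0) → p ∣ f.eval c → k • y = ((c : A) - a) * z →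
        p ∣ k * N := by
  classical
  -- Choose `f ≠ 0` of least degree `d + 1` with `f(a) y = 0`.
  have hex : ∃ d, ∃ f : ℤ[X], f ≠ 0 ∧ aeval a f * y = 0 ∧ f.natDegree = d := by
    obtain ⟨f, hf, h0⟩ := Algebra.IsIntegral.isIntegral (R := ℤ) a
    have h0 : aeval a f = 0 := h0
    exact ⟨_, f, hf.ne_zero, by rw [h0, zero_mul], rfl⟩
  obtain ⟨f, hf0, hfy, hfd⟩ := Nat.find_spec hex
  have hmin : ∀ g : ℤ[X], aeval a g * y = 0 → g.natDegree < f.natDegree → g = 0 := by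
    intro g hg hlt
    by_contra hg0
    exact Nat.find_min hex (hfd ▸ hlt) ⟨g, hg0, hg, rfl⟩
  have hdeg : 0 < f.natDegree := by
    rw [Nat.pos_iff_ne_zero]
    intro h0
    rw [natDegree_eq_zero] at h0
    obtain ⟨n, rfl⟩ := h0
    rw [aeval_C, ← Algebra.smul_def] at hfy
    rcases smul_eq_zero.1 hfy with h | h
    · exact hf0 (by simp [h])
    · exact hy h
  obtain ⟨d, hd⟩ : ∃ d, f.natDegree = d + 1 := ⟨_, (Nat.succ_pred_eq_of_pos hdeg).symm⟩
  let ev : ℤ[X] →ₗ[ℤ] A := (LinearMap.mulRight ℤ y).comp (aeval a).toLinearMap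
  have hev : ∀ g, ev g = aeval a g * y := fun g => rfl
  -- `l` kills `a^i y` for `i < d` but not `a^d y`. It exists because a multiple of `a^d y` in their
  -- span would give an annihilator of degree `d`, against minimality.
  obtain ⟨l, hl0, hl1⟩ := exists_dual_vanishing_of_forall_smul_notMem
    ((degreeLT ℤ d).map ev) (ev (X ^ d)) (by
      rintro n hn ⟨g, hg, hgn⟩
      rw [SetLike.mem_coe, mem_degreeLT] at hg
      have h1 : aeval a (n • (X : ℤ[X]) ^ d - g) * y = 0 := by
        rw [← hev, map_sub, map_smul, hgn, sub_self]
      have h2 : (n • (X : ℤ[X]) ^ d - g).natDegree < f.natDegree := by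
        rw [hd, Nat.lt_succ_iff]
        refine (natDegree_sub_le _ _).trans (max_le ?_ ?_)
        · exact (natDegree_smul_le _ _).trans (natDegree_X_pow_le d)
        · exact natDegree_le_of_degree_le hg.le
      have h3 := congrArg (fun q => coeff q d) (hmin _ h1 h2)
      have h4 : g.coeff d = 0 := coeff_eq_zero_of_degree_lt hg
      simp [h4] at h3
      exact hn h3)
  refine ⟨f, hdeg, f.leadingCoeff * l (ev (X ^ d)),
    mul_ne_zero (leadingCoeff_ne_zero.2 hf0) hl1, ?_⟩
  intro p k c z hreg hp hk
  -- With `f - f(c) = (X - c) g` and `f(a) z = 0`, one gets `f(c) z = k g(a) y`. Since `g` has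
  -- degree `d` and the leading coefficient of `f`, applying `l` leaves only its top term.
  obtain ⟨g, hg⟩ : (X - C c) ∣ f - C (f.eval c) := X_sub_C_dvd_sub_C_eval
  have hcomm : Commute ((c : A) - a) (aeval a f) := by
    exact Commute.sub_left (Int.cast_commute _ _) (commute_aeval_self a f)
  have hfz : aeval a f * z = 0 := by
    apply hreg
    rw [← mul_assoc, hcomm.eq, mul_assoc, ← hk, mul_smul_comm, hfy, smul_zero]
  have hgz : f.eval c • z = k • ev g := by
    have h1 := congrArg (fun q => aeval a q * z) hg
    simp only [map_sub, map_mul, aeval_X, aeval_C, sub_mul, hfz] at h1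
    have hcg : Commute (a - (c : A)) (aeval a g) :=
      Commute.sub_left (commute_aeval_self a g) (Int.cast_commute _ _)
    have h2 : (a * aeval a g * z - (algebraMap ℤ A) c * aeval a g * z)
        = -(aeval a g * (((c : A) - a) * z)) := by
      rw [← mul_assoc, ← neg_mul, ← mul_neg, neg_sub, ← hcg.eq, sub_mul, sub_mul]
      rfl
    rw [h2, ← hk, zero_sub, neg_inj] at h1
    rw [Algebra.smul_def, h1, hev, mul_smul_comm]
  have hgd : g.natDegree = d := by
    have h1 := congrArg natDegree hg
    rw [natDegree_sub_C, hd, natDegree_mul (X_sub_C_ne_zero c), natDegree_X_sub_C] at h1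
    · omega
    · rintro rfl
      rw [mul_zero, sub_eq_zero] at hg
      rw [hg, natDegree_C] at hdeg
      exact lt_irrefl _ hdeg
  have hglc : g.leadingCoeff = f.leadingCoeff := by
    have h1 := congrArg leadingCoeff hg
    rw [leadingCoeff_mul, leadingCoeff_X_sub_C, one_mul] at h1
    rw [← h1, leadingCoeff_sub_of_degree_lt]
    exact degree_C_le.trans_lt (natDegree_pos_iff_degree_pos.1 hdeg)
  have hlg : l (ev g) = f.leadingCoeff * l (ev (X ^ d)) := by
    have h1 : g = g.eraseLead + f.leadingCoeff • X ^ d := by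
      conv_lhs => rw [← g.eraseLead_add_C_mul_X_pow, hgd, hglc, ← smul_eq_C_mul]
    have h2 : l (ev g.eraseLead) = 0 := by
      refine hl0 _ ⟨_, ?_, rfl⟩
      rw [SetLike.mem_coe, mem_degreeLT]
      rcases eq_or_ne g.eraseLead 0 with h | h
      · rw [h, degree_zero]; exact WithBot.bot_lt_coe _
      · have hg0 : g ≠ 0 := by rintro rfl; simp at h
        refine (degree_eraseLead_lt hg0).trans_le ?_
        rw [degree_eq_natDegree hg0, hgd]
    rw [h1, map_add, map_add, h2, zero_add, map_smul, map_smul, smul_eq_mul]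
  have h3 := congrArg l hgz
  rw [map_smul, map_smul, hlg, smul_eq_mul, smul_eq_mul] at h3
  rw [← h3]
  exact hp.mul_right _

/-! ### Denominators and invertibility in `ℚA`. -/

theorem toQ_apply {A : Type*} [Ring A] (x : A) : toQ A x = (1 : ℚ) ⊗ₜ[ℤ] x := rfl

theorem toQ_injective (A : Type*) [Ring A] [Module.Free ℤ A] : Function.Injective (toQ A) := by
  exact Algebra.TensorProduct.includeRight_injective
    (RingHom.injective_int _)

/-- Every element of `ℚA` has a positive multiple in `A`. -/
theorem exists_nsmul_eq_toQ {A : Type*} [Ring A] (v : ℚ ⊗[ℤ] A) :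
    ∃ N : ℕ, 0 < N ∧ ∃ s : A, N • v = toQ A s := by
  induction v with
  | zero => exact ⟨1, one_pos, 0, by simp⟩
  | tmul q x =>
    refine ⟨q.den, q.den_pos, q.num • x, ?_⟩
    rw [toQ_apply, TensorProduct.tmul_smul, TensorProduct.smul_tmul', TensorProduct.smul_tmul']
    congr 1
    simp
  | add u v hu hv =>
    obtain ⟨m, hm, s, hs⟩ := hu
    obtain ⟨n, hn, t, ht⟩ := hv
    refine ⟨m * n, Nat.mul_pos hm hn, n • s + m • t, ?_⟩
    rw [smul_add, map_add, map_nsmul, map_nsmul, ← hs, ← ht, smul_smul, smul_smul, mul_comm n]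

open Polynomial in
-- If `f` is monic with `f(a) = 0`, then `(c - a) g(a) = f(c)` for some `g`, and `f(c) ≠ 0` once `c`
-- exceeds all integer roots of `f`.
theorem exists_forall_isUnit_toQ_intCast_sub {A : Type*} [Ring A] [Module.Finite ℤ A] (a : A) :
    ∃ B : ℤ, ∀ c : ℤ, B ≤ c → IsUnit (toQ A ((c : A) - a)) := by
  obtain ⟨f, hf, h0⟩ := Algebra.IsIntegral.isIntegral (R := ℤ) a
  have h0 : aeval a f = 0 := h0
  obtain ⟨B, hB⟩ := (f.rootSet_finite ℤ).bddAbove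
  refine ⟨B + 1, fun c hc => ?_⟩
  have hfc : f.eval c ≠ 0 := by
    intro h
    have := hB ((mem_rootSet.2 ⟨hf.ne_zero, by simpa using h⟩ : c ∈ f.rootSet ℤ))
    omega
  obtain ⟨g, hg⟩ : (X - C c) ∣ f - C (f.eval c) := X_sub_C_dvd_sub_C_eval
  have h1 : ((c : A) - a) * aeval a g = ((f.eval c : ℤ) : A) := by
    have := congrArg (aeval a) hg
    simp only [map_sub, map_mul, aeval_X, aeval_C, h0] at this
    rw [← neg_sub, neg_mul]
    simp only [algebraMap_int_eq, eq_intCast] at this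
    rw [← this]; simp
  have hcg : Commute ((c : A) - a) (aeval a g) :=
    Commute.sub_left (Int.cast_commute _ _) (commute_aeval_self a g)
  have h2 : IsUnit (toQ A ((f.eval c : ℤ) : A)) := by
    have : toQ A ((f.eval c : ℤ) : A) = algebraMap ℚ _ ((f.eval c : ℤ) : ℚ) := by simp
    rw [this]
    exact (IsUnit.mk0 _ (Int.cast_ne_zero.2 hfc)).map _
  rw [← h1, map_mul] at h2
  exact ((hcg.map (toQ A)).isUnit_mul_iff.1 h2).1

/-! ### Divergence of the reciprocal sum over primes modulo which a polynomial has a root. -/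

open NumberField Filter Topology in
-- The number of ideals of norm at most `s` is asymptotic to `κ s` with `κ > 0`. Summability would
-- leave a tail below `κ / 2`, in which each counted ideal contributes at least `1 / s`, so the
-- count would be at most `O(1) + κ s / 2`.
theorem not_summable_inv_absNorm_ideal (K : Type*) [Field K] [NumberField K] :
    ¬ Summable fun I : Ideal (𝓞 K) => (Ideal.absNorm I : ℝ)⁻¹ := by
  classical
  intro hsum
  have hlim := NumberField.Ideal.tendsto_norm_le_div_atTop K
  rw [← dedekindZeta_residue_def] at hlim
  set κ := dedekindZeta_residue K
  have hκ : 0 < κ := dedekindZeta_residue_pos K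
  obtain ⟨F, hF⟩ := summable_iff_vanishing_norm.1 hsum (κ / 2) (half_pos hκ)
  -- `⊥` is set aside with `F`: its norm is `0`, and `0⁻¹ = 0` is not at least `1 / s`.
  have hle : ∀ᶠ s : ℝ in atTop, (Nat.card {I : Ideal (𝓞 K) // (Ideal.absNorm I : ℝ) ≤ s} : ℝ) / s ≤
      (insert ⊥ F).card / s + κ / 2 := by
    filter_upwards [eventually_gt_atTop 0] with s hs
    have hfin : {I : Ideal (𝓞 K) | (Ideal.absNorm I : ℝ) ≤ s}.Finite := by
      simp_rw [← Nat.le_floor_iff hs.le]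
      exact Ideal.finite_setOfPred_absNorm_le _
    have hcard : Nat.card {I : Ideal (𝓞 K) // (Ideal.absNorm I : ℝ) ≤ s} = hfin.toFinset.card :=
      Nat.card_eq_card_finite_toFinset hfin
    have h1 : hfin.toFinset.card ≤ (insert ⊥ F).card + (hfin.toFinset \ insert ⊥ F).card := by
      rw [add_comm]; exact Finset.card_le_card_sdiff_add_card
    have h2 : ((hfin.toFinset \ insert ⊥ F).card : ℝ) / s ≤ κ / 2 := by
      have h3 := hF (hfin.toFinset \ insert ⊥ F)
        (Finset.disjoint_of_subset_right (Finset.subset_insert _ _) Finset.sdiff_disjoint)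
      refine le_trans ?_ ((le_abs_self _).trans h3.le)
      rw [div_eq_mul_inv, ← nsmul_eq_mul]
      refine Finset.card_nsmul_le_sum _ _ _ fun I hI => ?_
      simp only [Finset.mem_sdiff, Set.Finite.mem_toFinset, Set.mem_ofPred_eq, Finset.mem_insert,
        not_or] at hI
      refine inv_anti₀ ?_ hI.1
      exact_mod_cast Nat.pos_of_ne_zero (mt Ideal.absNorm_eq_zero_iff.1 hI.2.1)
    rw [hcard]
    calc (hfin.toFinset.card : ℝ) / s
        ≤ ((insert ⊥ F).card + (hfin.toFinset \ insert ⊥ F).card) / s := by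
          gcongr; exact_mod_cast h1
      _ ≤ _ := by rw [add_div]; gcongr
  have hlim2 : Tendsto (fun s : ℝ => ((insert ⊥ F).card : ℝ) / s + κ / 2) atTop (𝓝 (0 + κ / 2)) :=
    (tendsto_const_nhds.div_atTop tendsto_id).add tendsto_const_nhds
  have := le_of_tendsto_of_tendsto hlim hlim2 hle
  linarith

section Ideals

variable {R : Type*} [CommRing R] [IsDedekindDomain R] [Module.Free ℤ R] [Module.Finite ℤ R]

theorem two_le_absNorm_of_prime [CharZero R] {P : Ideal R} (hP : Prime P) :
    2 ≤ Ideal.absNorm P := by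
  have h0 : Ideal.absNorm P ≠ 0 := mt Ideal.absNorm_eq_zero_iff.1 hP.ne_zero
  have h1 : Ideal.absNorm P ≠ 1 := fun h =>
    hP.not_isUnit (Ideal.isUnit_iff.2 (Ideal.absNorm_eq_one_iff.1 h))
  omega

open UniqueFactorizationMonoid in
-- Euler product: by unique factorization a finite partial sum is bounded by a product of truncated
-- geometric series in `x = 1 / N(P) ≤ 1 / 2`, and `1 / (1 - x) ≤ 1 + 2x ≤ exp (2x)`.
theorem summable_inv_absNorm_ideal_of_prime [CharZero R]
    (h : Summable ({P : Ideal R | Prime P}.indicator fun P => (Ideal.absNorm P : ℝ)⁻¹)) :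
    Summable fun I : Ideal R => (Ideal.absNorm I : ℝ)⁻¹ := by
  classical
  set g := {P : Ideal R | Prime P}.indicator fun P => (Ideal.absNorm P : ℝ)⁻¹ with hg
  have hg0 : ∀ P, 0 ≤ g P := fun P => Set.indicator_nonneg (fun _ _ => by positivity) _
  refine summable_of_sum_le (c := Real.exp (∑' P, 2 * g P)) (fun I => by positivity) fun G => ?_
  have hbot : ∑ I ∈ G, (Ideal.absNorm I : ℝ)⁻¹ = ∑ I ∈ G.erase ⊥, (Ideal.absNorm I : ℝ)⁻¹ := by
    by_cases hm : ⊥ ∈ G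
    · rw [← Finset.add_sum_erase _ _ hm]; simp
    · rw [Finset.erase_eq_of_notMem hm]
  rw [hbot]
  set G' := G.erase ⊥
  set F : Finset (Ideal R) := G'.biUnion fun I => (normalizedFactors I).toFinset with hF
  set n : ℕ := G'.sup (fun I => (normalizedFactors I).card) + 1 with hn
  have hFp : ∀ P ∈ F, Prime P := by
    intro P hP
    obtain ⟨I, -, hI⟩ := Finset.mem_biUnion.1 hP
    exact prime_of_normalized_factor P (Multiset.mem_toFinset.1 hI)
  have hprod : ∀ I ∈ G', ∏ P ∈ F, P ^ (normalizedFactors I).count P = I := by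
    intro I hI
    rw [← Finset.prod_multiset_count_of_subset]
    · exact associated_iff_eq.1 (prod_normalizedFactors (Finset.ne_of_mem_erase hI))
    · exact Finset.subset_biUnion_of_mem (fun I => (normalizedFactors I).toFinset) hI
  calc ∑ I ∈ G', (Ideal.absNorm I : ℝ)⁻¹
      = ∑ I ∈ G', ∏ x ∈ F.attach,
          ((Ideal.absNorm x.1 : ℝ)⁻¹) ^ (normalizedFactors I).count x.1 := by
        refine Finset.sum_congr rfl fun I hI => ?_
        rw [Finset.prod_attach F
          (fun P => ((Ideal.absNorm P : ℝ)⁻¹) ^ (normalizedFactors I).count P)]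
        conv_lhs => rw [← hprod I hI]
        simp
    _ = ∑ q ∈ G'.image (fun I => (fun P (_ : P ∈ F) => (normalizedFactors I).count P)),
          ∏ x ∈ F.attach, ((Ideal.absNorm x.1 : ℝ)⁻¹) ^ q x.1 x.2 := by
        rw [Finset.sum_image]
        intro I hI J hJ hIJ
        rw [← hprod I hI, ← hprod J hJ]
        refine Finset.prod_congr rfl fun P hP => ?_
        rw [show (normalizedFactors I).count P = (normalizedFactors J).count P from
          congrFun (congrFun hIJ P) hP]
    _ ≤ ∑ q ∈ F.pi fun _ => Finset.range n,
          ∏ x ∈ F.attach, ((Ideal.absNorm x.1 : ℝ)⁻¹) ^ q x.1 x.2 := by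
        refine Finset.sum_le_sum_of_subset_of_nonneg ?_ fun _ _ _ => by positivity
        intro q hq
        obtain ⟨I, hI, rfl⟩ := Finset.mem_image.1 hq
        refine Finset.mem_pi.2 fun P hP => Finset.mem_range.2 ?_
        rw [hn, Nat.lt_succ_iff]
        exact (Multiset.count_le_card _ _).trans
          (Finset.le_sup (f := fun I => (normalizedFactors I).card) hI)
    _ = ∏ P ∈ F, ∑ e ∈ Finset.range n, ((Ideal.absNorm P : ℝ)⁻¹) ^ e := by
        rw [Finset.prod_sum]
    _ ≤ ∏ P ∈ F, Real.exp (2 * g P) := by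
        refine Finset.prod_le_prod (fun _ _ => by positivity) fun P hP => ?_
        have hgP : g P = (Ideal.absNorm P : ℝ)⁻¹ := Set.indicator_of_mem (show P ∈ {P : Ideal R | Prime P} from hFp P hP) _
        rw [hgP]
        have h2 : (2 : ℝ) ≤ Ideal.absNorm P := by exact_mod_cast two_le_absNorm_of_prime (hFp P hP)
        set x := (Ideal.absNorm P : ℝ)⁻¹ with hx
        have hx0 : 0 ≤ x := by positivity
        have hx1 : x ≤ 1 / 2 := by rw [hx, one_div]; exact inv_anti₀ two_pos h2
        have hgeom : ∑ e ∈ Finset.range n, x ^ e ≤ (1 - x)⁻¹ := by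
          rw [← tsum_geometric_of_lt_one hx0 (by linarith)]
          exact (summable_geometric_of_lt_one hx0 (by linarith)).sum_le_tsum _
            fun _ _ => by positivity
        have : (1 - x)⁻¹ ≤ 2 * x + 1 := by
          rw [inv_le_iff_one_le_mul₀ (by linarith)]
          nlinarith
        exact hgeom.trans (this.trans (Real.add_one_le_exp _))
    _ = Real.exp (∑ P ∈ F, 2 * g P) := (Real.exp_sum _ _).symm
    _ ≤ Real.exp (∑' P, 2 * g P) :=
        Real.exp_le_exp.2 ((h.mul_left 2).sum_le_tsum _ fun P _ => mul_nonneg zero_le_two (hg0 P))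

/-- The product of distinct primes over `p` divides `(p)`, whose norm is `p` to the rank. -/
theorem card_le_finrank_of_forall_prime [CharZero R] {p : ℕ} (hp : p.Prime) (T : Finset (Ideal R))
    (hT : ∀ P ∈ T, Prime P ∧ ∃ n, 0 < n ∧ (p : R) ∈ P ∧ Ideal.absNorm P = p ^ n) :
    T.card ≤ Module.finrank ℤ R := by
  have h1 : ∏ P ∈ T, P ∣ Ideal.span {(p : R)} := by
    refine Finset.prod_primes_dvd _ (fun P hP => (hT P hP).1) fun P hP => ?_
    obtain ⟨-, -, -, h, -⟩ := hT P hP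
    exact Ideal.dvd_span_singleton.2 h
  have h2 := map_dvd Ideal.absNorm h1
  rw [Ideal.absNorm_span_natCast, map_prod] at h2
  have h3 : p ^ T.card ∣ ∏ P ∈ T, Ideal.absNorm P := by
    rw [← Finset.prod_const]
    refine Finset.prod_dvd_prod_of_dvd _ _ fun P hP => ?_
    obtain ⟨-, n, hn, -, h⟩ := hT P hP
    rw [h]
    exact dvd_pow_self _ hn.ne'
  exact (Nat.pow_dvd_pow_iff_le_right hp.one_lt).1 (h3.trans h2)

theorem summable_inv_absNorm_prime_of_degree_one [CharZero R] (S : Set ℕ)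
    (hS : ∀ (P : Ideal R) (p : ℕ), p.Prime → P.IsPrime → Ideal.absNorm P = p → p ∈ S)
    (hsum : Summable (S.indicator fun n : ℕ => (n : ℝ)⁻¹)) :
    Summable ({P : Ideal R | Prime P}.indicator fun P => (Ideal.absNorm P : ℝ)⁻¹) := by
  classical
  -- `h p` bounds `1 / N(P)` for `P` over `p`: the first term serves residue degree one, the second
  -- all higher degrees.
  set h : ℕ → ℝ := fun n => S.indicator (fun n : ℕ => (n : ℝ)⁻¹) n + ((n : ℝ) ^ 2)⁻¹ with hh
  have hs : Summable h := hsum.add (Real.summable_nat_pow_inv.2 one_lt_two)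
  have hi0 : ∀ n, 0 ≤ S.indicator (fun n : ℕ => (n : ℝ)⁻¹) n := fun n =>
    Set.indicator_nonneg (fun _ _ => by positivity) _
  have hh0 : ∀ n, 0 ≤ h n := fun n => add_nonneg (hi0 n) (by positivity)
  have hex : ∀ P : Ideal R, ∃ p : ℕ, Prime P → p.Prime ∧ ∃ n, 0 < n ∧ (p : R) ∈ P ∧
      Ideal.absNorm P = p ^ n := by
    intro P
    by_cases hP : Prime P
    · have := (Ideal.isPrime_of_prime hP).isMaximal hP.ne_zero
      obtain ⟨p, n, hn, hm, hp, hN⟩ := Ideal.exists_prime_and_absNorm_eq_pow P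
      exact ⟨p, fun _ => ⟨hp, n, hn, hm, hN⟩⟩
    · exact ⟨0, fun h => absurd h hP⟩
  choose q hq using hex
  refine summable_of_sum_le (c := Module.finrank ℤ R * ∑' n, h n)
    (fun I => Set.indicator_nonneg (fun _ _ => by positivity) _) fun T => ?_
  rw [Finset.sum_indicator_eq_sum_filter]
  set T' := T.filter fun P => P ∈ {P : Ideal R | Prime P} with hT'
  have hmem : ∀ P ∈ T', Prime P := fun P hP => (Finset.mem_filter.1 hP).2
  calc ∑ P ∈ T', (Ideal.absNorm P : ℝ)⁻¹ ≤ ∑ P ∈ T', h (q P) := by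
        refine Finset.sum_le_sum fun P hP => ?_
        obtain ⟨hp, n, hn, hm, hN⟩ := hq P (hmem P hP)
        rcases (Nat.succ_le_of_lt hn).eq_or_lt with h1 | h1
        · have h1 : n = 1 := h1.symm
          rw [h1, pow_one] at hN
          have := hS P (q P) hp (Ideal.isPrime_of_prime (hmem P hP)) hN
          rw [hh, hN]
          dsimp only
          rw [Set.indicator_of_mem this]
          exact le_add_of_nonneg_right (by positivity)
        · refine le_trans ?_ (le_add_of_nonneg_left (hi0 _))
          rw [hN, Nat.cast_pow]
          have : (1 : ℝ) ≤ q P := by exact_mod_cast hp.one_lt.le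
          exact inv_anti₀ (by positivity) (pow_le_pow_right₀ this h1)
    _ = ∑ p ∈ T'.image q, (T'.filter fun P => q P = p).card • h p := Finset.sum_comp h q
    _ ≤ ∑ p ∈ T'.image q, Module.finrank ℤ R * h p := by
        refine Finset.sum_le_sum fun p hp => ?_
        obtain ⟨P, hP, rfl⟩ := Finset.mem_image.1 hp
        rw [nsmul_eq_mul]
        refine mul_le_mul_of_nonneg_right ?_ (hh0 _)
        norm_cast
        refine card_le_finrank_of_forall_prime (hq P (hmem P hP)).1 _ fun Q hQ => ?_
        rw [Finset.mem_filter] at hQ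
        rw [← hQ.2]
        exact ⟨hmem Q hQ.1, (hq Q (hmem Q hQ.1)).2⟩
    _ ≤ Module.finrank ℤ R * ∑' n, h n := by
        rw [← Finset.mul_sum]
        exact mul_le_mul_of_nonneg_left (hs.sum_le_tsum _ fun n _ => hh0 n) (by positivity)

end Ideals

/-- The reciprocals of the residue characteristics of the degree one primes of a number field have
infinite sum. -/
theorem not_summable_inv_of_degree_one_primes (K : Type*) [Field K] [NumberField K] (S : Set ℕ)
    (hS : ∀ (P : Ideal (NumberField.RingOfIntegers K)) (p : ℕ), p.Prime → P.IsPrime →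
      Ideal.absNorm P = p → p ∈ S) :
    ¬ Summable (S.indicator fun n : ℕ => (n : ℝ)⁻¹) := fun h =>
  not_summable_inv_absNorm_ideal K
    (summable_inv_absNorm_ideal_of_prime (summable_inv_absNorm_prime_of_degree_one S hS h))

open Polynomial in
-- The residue field at `P` is `𝔽_p`, and `b` plays the role of the leading coefficient times a root
-- of `f`; its image can be divided by that coefficient.
theorem exists_dvd_eval_of_absNorm_eq {R : Type*} [CommRing R] [IsDedekindDomain R]
    [Module.Free ℤ R] [Module.Finite ℤ R] (f : ℤ[X]) (b : R)
    (hb : aeval b (f.scaleRoots f.leadingCoeff) = 0) (P : Ideal R) {p : ℕ} (hp : p.Prime)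
    (hN : Ideal.absNorm P = p) (hlc : ¬ (p : ℤ) ∣ f.leadingCoeff) :
    ∃ c : ℤ, (p : ℤ) ∣ f.eval c := by
  have : Fact p.Prime := ⟨hp⟩
  have hfin : Finite (R ⧸ P) := (Ideal.absNorm_ne_zero_iff P).1 (hN ▸ hp.ne_zero)
  have := Fintype.ofFinite (R ⧸ P)
  have hcard : Fintype.card (R ⧸ P) = p := by
    rw [← hN, ← Nat.card_eq_fintype_card]; rfl
  let θ : R →+* ZMod p :=
    (ZMod.ringEquivOfPrime (R ⧸ P) hp hcard).symm.toRingHom.comp (Ideal.Quotient.mk P)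
  have hl : (f.leadingCoeff : ZMod p) ≠ 0 := by
    rwa [Ne, ZMod.intCast_zmod_eq_zero_iff_dvd]
  have h1 : eval₂ (Int.castRingHom (ZMod p)) (θ b) (f.scaleRoots f.leadingCoeff) = 0 := by
    have := congrArg θ hb
    rwa [map_zero, aeval_def, hom_eval₂, RingHom.ext_int (θ.comp _) (Int.castRingHom _)] at this
  obtain ⟨c, hc⟩ := ZMod.intCast_surjective (θ b / (f.leadingCoeff : ZMod p))
  refine ⟨c, ?_⟩
  have h2 : θ b = Int.castRingHom (ZMod p) f.leadingCoeff * (c : ZMod p) := by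
    rw [hc, eq_intCast, mul_div_cancel₀ _ hl]
  rw [h2, scaleRoots_eval₂_mul] at h1
  have h3 := (mul_eq_zero.1 h1).resolve_left (pow_ne_zero _ (by simpa using hl))
  rw [← ZMod.intCast_zmod_eq_zero_iff_dvd]
  rw [← eq_intCast (Int.castRingHom (ZMod p)) c, eval₂_at_apply] at h3
  exact h3

open Polynomial NumberField in
/-- The sum of the reciprocals of the primes modulo which a nonconstant integer polynomial has a
root diverges. -/
theorem not_summable_inv_primes_with_root (f : ℤ[X]) (hf : 0 < f.natDegree) :
    ¬ Summable ({p : ℕ | p.Prime ∧ ∃ c : ℤ, (p : ℤ) ∣ f.eval c}.indicator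
      fun n : ℕ => (n : ℝ)⁻¹) := by
  intro hsum
  have hf0 : f ≠ 0 := by rintro rfl; simp at hf
  have hinj : Function.Injective (algebraMap ℤ ℂ) := by
    simpa using (Int.cast_injective (α := ℂ))
  obtain ⟨α, hα⟩ : ∃ α : ℂ, aeval α f = 0 := by
    have hdeg : (f.map (algebraMap ℤ ℂ)).degree ≠ 0 := by
      rw [degree_map_eq_of_injective hinj]
      exact (natDegree_pos_iff_degree_pos.1 hf).ne'
    obtain ⟨α, hα⟩ := IsAlgClosed.exists_root _ hdeg
    exact ⟨α, by rwa [IsRoot, eval_map_algebraMap] at hα⟩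
  have halg : IsAlgebraic ℤ α := ⟨f, hf0, hα⟩
  have hint : IsIntegral ℚ α := (halg.extendScalars (algebraMap ℤ ℚ).injective_int).isIntegral
  let K := IntermediateField.adjoin ℚ {α}
  have : FiniteDimensional ℚ K := IntermediateField.adjoin.finiteDimensional hint
  have : NumberField K := ⟨⟩
  let β : K := IntermediateField.AdjoinSimple.gen ℚ α
  have hβ : aeval β f = 0 := by
    apply (algebraMap K ℂ).injective
    rw [map_zero, ← aeval_algebraMap_apply]
    exact hα
  let b : 𝓞 K := ⟨f.leadingCoeff • β, isIntegral_leadingCoeff_smul f β hβ⟩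
  have hb : aeval b (f.scaleRoots f.leadingCoeff) = 0 := by
    apply RingOfIntegers.coe_injective
    rw [map_zero, ← aeval_algebraMap_apply]
    have := scaleRoots_aeval_eq_zero (r := f.leadingCoeff) hβ
    rw [← Algebra.smul_def] at this
    exact this
  have hfin : {p : ℕ | (p : ℤ) ∣ f.leadingCoeff}.Finite := by
    refine (Set.finite_Iic f.leadingCoeff.natAbs).subset fun p hp => ?_
    exact Nat.le_of_dvd (Int.natAbs_pos.2 (leadingCoeff_ne_zero.2 hf0)) (Int.natCast_dvd.1 hp)
  refine not_summable_inv_of_degree_one_primes K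
    ({p : ℕ | p.Prime ∧ ∃ c : ℤ, (p : ℤ) ∣ f.eval c} ∪ {p : ℕ | (p : ℤ) ∣ f.leadingCoeff}) ?_ ?_
  · intro P p hp _ hN
    by_cases hlc : (p : ℤ) ∣ f.leadingCoeff
    · exact Or.inr hlc
    · exact Or.inl ⟨hp, exists_dvd_eval_of_absNorm_eq f b hb P hp hN hlc⟩
  · refine Summable.of_nonneg_of_le
      (fun n => Set.indicator_nonneg (fun _ _ => by positivity) _) (fun n => ?_)
      (hsum.add (summable_of_hasFiniteSupport (f := {p : ℕ | (p : ℤ) ∣ f.leadingCoeff}.indicator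
        fun n : ℕ => (n : ℝ)⁻¹) (hfin.subset Set.support_indicator_subset)))
    by_cases h1 : n ∈ {p : ℕ | p.Prime ∧ ∃ c : ℤ, (p : ℤ) ∣ f.eval c}
    · rw [Set.indicator_of_mem (Set.mem_union_left _ h1), Set.indicator_of_mem h1]
      exact le_add_of_nonneg_right (Set.indicator_nonneg (fun _ _ => by positivity) _)
    · by_cases h2 : n ∈ {p : ℕ | (p : ℤ) ∣ f.leadingCoeff}
      · rw [Set.indicator_of_mem (Set.mem_union_right _ h2), Set.indicator_of_notMem h1, zero_add,
          Set.indicator_of_mem h2]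
      · rw [Set.indicator_of_notMem (fun h => h.elim h1 h2),
          Set.indicator_of_notMem h1, Set.indicator_of_notMem h2, zero_add]

/-! ### Probability: the second Borel–Cantelli lemma. -/

/-- The interval consists of `p` consecutive integers, so it meets the residue class contained in
`D`. -/
theorem inv_le_uniformOn_Icc {p : ℕ} (hp : 0 < p) (D : Set ℤ)
    (hD : ∃ c₀ ∈ D, ∀ c : ℤ, (p : ℤ) ∣ c - c₀ → c ∈ D) :
    (p : ℝ≥0∞)⁻¹ ≤ uniformOn (Set.Icc (p : ℤ) (2 * p - 1)) D := by
  obtain ⟨c₀, -, hc⟩ := hD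
  set c₁ : ℤ := p + c₀ % p with hc₁
  have hp' : (0 : ℤ) < p := by exact_mod_cast hp
  have h0 := Int.emod_nonneg c₀ hp'.ne'
  have h1 := Int.emod_lt_of_pos c₀ hp'
  have hmem : c₁ ∈ Finset.Icc (p : ℤ) (2 * p - 1) := by
    rw [Finset.mem_Icc]; omega
  have hcD : c₁ ∈ D := by
    refine hc _ ?_
    have := Int.emod_add_mul_ediv c₀ p
    exact ⟨1 - c₀ / p, by rw [mul_sub]; linarith⟩
  calc (p : ℝ≥0∞)⁻¹ = uniformOn (Finset.Icc (p : ℤ) (2 * p - 1) : Set ℤ) ({c₁} : Finset ℤ) := by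
        rw [uniformOn_apply_finset, Finset.inter_singleton_of_mem hmem, Finset.card_singleton,
          Int.card_Icc, show ((2 * p - 1 + 1 - p : ℤ)).toNat = p by omega]
        simp
    _ ≤ _ := by
        rw [Finset.coe_Icc]
        exact measure_mono (by simpa using hcD)

open Polynomial Filter in
theorem ZassenhausDistribution.ae_frequently_dvd_eval {Ω : Type*} [MeasurableSpace Ω] {A : Type*}
    [Ring A] [MeasurableSpace A] [DiscreteMeasurableSpace A] {μ : Measure Ω}
    [IsProbabilityMeasure μ] {a : Nat.Primes → Ω → A} {c : Nat.Primes → Ω → ℤ}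
    (h : ZassenhausDistribution μ a c) (x : A) (hx : x ≠ 0) (f : ℤ[X]) (hf : 0 < f.natDegree) :
    ∀ᵐ ω ∂μ, ∃ᶠ p : Nat.Primes in cofinite,
      a p ω = x ∧ ((p : ℕ) : ℤ) ∣ f.eval (c p ω) := by
  obtain ⟨δ, hδ, hδx⟩ := h.a_charges x hx
  let D : Nat.Primes → Set (A × ℤ) := fun p => {x} ×ˢ {n : ℤ | ((p : ℕ) : ℤ) ∣ f.eval n}
  have hDm : ∀ p, MeasurableSet (D p) := fun p =>
    (MeasurableSet.of_discrete).prod (MeasurableSet.of_discrete)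
  let E : Nat.Primes → Set Ω := fun p => (fun ω => (a p ω, c p ω)) ⁻¹' D p
  have hEm : ∀ p, MeasurableSet (E p) := fun p =>
    ((h.measurable_a p).prodMk (h.measurable_c p)) (hDm p)
  have hind : iIndepSet E μ := by
    rw [iIndepSet_iff_meas_biInter hEm]
    intro s
    exact h.indep_pairs.measure_inter_preimage_eq_mul s fun p _ => hDm p
  have hE : ∀ p : Nat.Primes, (∃ n : ℤ, ((p : ℕ) : ℤ) ∣ f.eval n) →
      δ * ((p : ℕ) : ℝ≥0∞)⁻¹ ≤ μ (E p) := by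
    rintro p ⟨n, hn⟩
    have h1 : μ (E p) = μ (a p ⁻¹' {x}) * μ (c p ⁻¹' {n : ℤ | ((p : ℕ) : ℤ) ∣ f.eval n}) :=
      (h.indep_entries p).measure_inter_preimage_eq_mul {x}
        {n : ℤ | ((p : ℕ) : ℤ) ∣ f.eval n} MeasurableSet.of_discrete MeasurableSet.of_discrete
    rw [h1]
    refine mul_le_mul' (hδx p) ?_
    rw [← Measure.map_apply (h.measurable_c p) MeasurableSet.of_discrete, h.uniform_c]
    refine inv_le_uniformOn_Icc p.2.pos _ ⟨n, hn, fun m hm => ?_⟩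
    exact (dvd_iff_dvd_of_dvd_sub (hm.trans (sub_dvd_eval_sub m n f))).2 hn
  have hsum : ∑' p, μ (E p) = ∞ := by
    by_contra hne
    have hs := ENNReal.summable_toReal hne
    refine not_summable_inv_primes_with_root f hf ?_
    set S := {p : ℕ | p.Prime ∧ ∃ c : ℤ, (p : ℤ) ∣ f.eval c}
    have hδt : δ ≠ ∞ := ne_top_of_le_ne_top (measure_ne_top μ _) (hδx ⟨2, Nat.prime_two⟩)
    have hδ0 : 0 < δ.toReal := ENNReal.toReal_pos hδ.ne' hδt
    have h1 : Summable ((S.indicator fun n : ℕ => (n : ℝ)⁻¹) ∘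
        ((↑) : {p : ℕ | p.Prime} → ℕ)) := by
      refine Summable.of_nonneg_of_le
        (fun n => Set.indicator_nonneg (fun _ _ => by positivity) _) (fun p => ?_)
        (hs.mul_left δ.toReal⁻¹)
      rw [Function.comp_apply]
      by_cases hp : (p : ℕ) ∈ S
      · rw [Set.indicator_of_mem hp, inv_mul_eq_div, le_div_iff₀ hδ0, mul_comm]
        have := ENNReal.toReal_mono (measure_ne_top μ _) (hE p hp.2)
        simpa using this
      · rw [Set.indicator_of_notMem hp]
        positivity
    have h2 := summable_subtype_iff_indicator.1 h1
    rwa [Set.indicator_indicator, Set.inter_eq_right.2 fun p hp => hp.1] at h2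
  obtain ⟨e⟩ : Nonempty (ℕ ≃ Nat.Primes) := by
    have : Infinite Nat.Primes := Nat.Primes.infinite
    exact nonempty_equiv_of_countable
  have hlim := measure_limsup_eq_one (fun n => hEm (e n)) (iIndepSet.precomp (s := E) e.injective hind)
    (by rw [← hsum]; exact e.tsum_eq fun p => μ (E p))
  have hae : ∀ᵐ ω ∂μ, ω ∈ limsup (E ∘ e) atTop := by
    rw [← mem_ae_iff_prob_eq_one] at hlim
    · exact hlim
    · exact MeasurableSet.measurableSet_limsup fun n => hEm (e n)
  filter_upwards [hae] with ω hω
  rw [mem_limsup_iff_frequently_mem, ← Nat.cofinite_eq_atTop] at hω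
  exact e.injective.tendsto_cofinite.frequently hω

open Polynomial Filter in
theorem ZassenhausDistribution.ae_forall_frequently_dvd_eval {Ω : Type*} [MeasurableSpace Ω]
    {A : Type*} [Ring A] [Countable A] [MeasurableSpace A] [DiscreteMeasurableSpace A]
    {μ : Measure Ω} [IsProbabilityMeasure μ] {a : Nat.Primes → Ω → A} {c : Nat.Primes → Ω → ℤ}
    (h : ZassenhausDistribution μ a c) :
    ∀ᵐ ω ∂μ, ∀ x : A, x ≠ 0 → ∀ f : ℤ[X], 0 < f.natDegree →
      ∃ᶠ p : Nat.Primes in cofinite, a p ω = x ∧ ((p : ℕ) : ℤ) ∣ f.eval (c p ω) := by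
  have : Countable ℤ[X] := by
    rw [← Cardinal.mk_le_aleph0_iff]
    exact Polynomial.cardinalMk_le_max.trans (by simp)
  refine ae_all_iff.2 fun x => ?_
  by_cases hx : x = 0
  · exact Eventually.of_forall fun ω hx' => absurd hx hx'
  have := ae_all_iff.2 fun f : {f : ℤ[X] // 0 < f.natDegree} =>
    h.ae_frequently_dvd_eval x hx f.1 f.2
  filter_upwards [this] with ω hω _ f hf using hω ⟨f, hf⟩

theorem ZassenhausDistribution.ae_le_c {Ω : Type*} [MeasurableSpace Ω] {A : Type*}
    [Ring A] [MeasurableSpace A] {μ : Measure Ω} {a : Nat.Primes → Ω → A} {c : Nat.Primes → Ω → ℤ}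
    (h : ZassenhausDistribution μ a c) : ∀ᵐ ω ∂μ, ∀ p : Nat.Primes, ((p : ℕ) : ℤ) ≤ c p ω := by
  refine ae_all_iff.2 fun p => ?_
  have h1 : ∀ᵐ n ∂(μ.map (c p)), ((p : ℕ) : ℤ) ≤ n := by
    rw [h.uniform_c, uniformOn]
    filter_upwards [ae_cond_mem (μ := Measure.count) (s := Set.Icc ((p : ℕ) : ℤ) (2 * (p : ℕ) - 1))
      measurableSet_Icc] with n hn using hn.1
  exact ae_of_ae_map (h.measurable_c p).aemeasurable h1

/-! ### Localization at a prime. -/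

/-- The elements of `V` that have a multiple prime to `p` in the subgroup `B`. -/
def primeSaturation {V : Type*} [AddCommGroup V] (p : ℕ) (B : AddSubgroup V) : AddSubgroup V where
  carrier := {v | ∃ k : ℕ, k.Coprime p ∧ k • v ∈ B}
  zero_mem' := ⟨1, Nat.coprime_one_left p, by simp⟩
  add_mem' := by
    rintro v w ⟨k, hk, hv⟩ ⟨l, hl, hw⟩
    refine ⟨k * l, Nat.Coprime.mul_left hk hl, ?_⟩
    rw [smul_add]
    refine B.add_mem ?_ ?_
    · rw [mul_comm, mul_smul]; exact B.nsmul_mem hv l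
    · rw [mul_smul]; exact B.nsmul_mem hw k
  neg_mem' := by
    rintro v ⟨k, hk, hv⟩
    exact ⟨k, hk, by rw [smul_neg]; exact B.neg_mem hv⟩

theorem le_primeSaturation {V : Type*} [AddCommGroup V] (p : ℕ) (B : AddSubgroup V) :
    B ≤ primeSaturation p B := fun v hv => ⟨1, Nat.coprime_one_left p, by rwa [one_smul]⟩

theorem mem_primeSaturation_of_nsmul_mem {V : Type*} [AddCommGroup V] {p n : ℕ}
    {B : AddSubgroup V} {v : V} (hn : n.Coprime p) (h : n • v ∈ primeSaturation p B) :
    v ∈ primeSaturation p B := by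
  obtain ⟨k, hk, hv⟩ := h
  exact ⟨k * n, Nat.Coprime.mul_left hk hn, by rwa [mul_smul]⟩

theorem mem_of_forall_mem_primeSaturation {V : Type*} [AddCommGroup V] {B : AddSubgroup V} {v : V}
    (h : ∀ p : Nat.Primes, v ∈ primeSaturation p B) : v ∈ B := by
  rw [← QuotientAddGroup.eq_zero_iff, ← AddMonoid.addOrderOf_eq_one_iff]
  by_contra hne
  -- Infinite order, recorded as `0`, needs no separate case: `minFac 0 = 2`.
  obtain ⟨k, hk, hv⟩ := h ⟨_, Nat.minFac_prime hne⟩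
  rw [← QuotientAddGroup.eq_zero_iff, QuotientAddGroup.mk_nsmul, ← addOrderOf_dvd_iff_nsmul_eq_zero]
    at hv
  have h1 := (Nat.minFac_dvd _).trans hv
  have h2 := Nat.dvd_gcd h1 dvd_rfl
  rw [show Nat.gcd _ _ = 1 from hk, Nat.dvd_one] at h2
  exact (Nat.minFac_prime hne).one_lt.ne' h2

theorem nsmul_left_cancel_of_rat_module {V : Type*} [AddCommGroup V] [Module ℚ V] {n : ℕ}
    (hn : n ≠ 0) {v w : V} (h : n • v = n • w) : v = w := by
  rw [← Nat.cast_smul_eq_nsmul ℚ, ← Nat.cast_smul_eq_nsmul ℚ] at h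
  exact smul_right_injective V (Nat.cast_ne_zero.2 hn : (n : ℚ) ≠ 0) h

theorem nsmul_inv_pow_smul {V : Type*} [AddCommGroup V] [Module ℚ V] (p : Nat.Primes) (r : ℕ)
    (v : V) : ((p : ℕ) ^ r) • ((((p : ℕ) : ℚ) ^ r)⁻¹ • v) = v := by
  rw [← Nat.cast_smul_eq_nsmul ℚ, Nat.cast_pow]
  exact smul_inv_smul₀ (pow_ne_zero _ (Nat.cast_ne_zero.2 p.2.ne_zero)) v

/-! ### The group `M` and its endomorphisms. -/

section Zassenhaus

variable {A : Type*} [Ring A] {a : Nat.Primes → A} {c : Nat.Primes → ℤ} {r : Nat.Primes → ℕ}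

theorem toQ_mem_zassenhausGroup (x : A) : toQ A x ∈ zassenhausGroup a c r :=
  AddSubgroup.subset_closure (Or.inl ⟨x, rfl⟩)

theorem inv_pow_smul_mem_zassenhausGroup {p : Nat.Primes} (hp : InvertibleAt a c p) (b : A) :
    (((p : ℕ) : ℚ) ^ r p)⁻¹ • toQ A (((c p : A) - a p) * b) ∈ zassenhausGroup a c r :=
  AddSubgroup.subset_closure (Or.inr ⟨p, hp, b, rfl⟩)

theorem zassenhausGroup_mul_mem {v : ℚ ⊗[ℤ] A} (hv : v ∈ zassenhausGroup a c r) (x : A) :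
    v * toQ A x ∈ zassenhausGroup a c r := by
  induction hv using AddSubgroup.closure_induction with
  | mem v hv =>
    rcases hv with ⟨b, rfl⟩ | ⟨p, hp, b, rfl⟩
    · rw [← map_mul]; exact toQ_mem_zassenhausGroup _
    · rw [smul_mul_assoc, ← map_mul, mul_assoc]
      exact inv_pow_smul_mem_zassenhausGroup hp _
  | zero => rw [zero_mul]; exact zero_mem _
  | add v w _ _ hv hw => rw [add_mul]; exact add_mem hv hw
  | neg v _ hv =>
    have h : -v * toQ A x = -(v * toQ A x) := neg_mul v (toQ A x)
    exact h ▸ neg_mem hv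

/-- Generators attached to `q ≠ p` have a multiple by a power of `q` in `A`, so only `A` and the
generators at `p` matter locally at `p`. -/
theorem zassenhausGroup_le_primeSaturation {p : Nat.Primes} {B : AddSubgroup (ℚ ⊗[ℤ] A)}
    (hB : ∀ b, toQ A b ∈ primeSaturation p B)
    (hp : InvertibleAt a c p → ∀ b,
      (((p : ℕ) : ℚ) ^ r p)⁻¹ • toQ A (((c p : A) - a p) * b) ∈ primeSaturation p B) :
    zassenhausGroup a c r ≤ primeSaturation p B := by
  refine (AddSubgroup.closure_le _).2 ?_
  rintro v (⟨b, rfl⟩ | ⟨q, hq, b, rfl⟩)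
  · exact hB b
  · by_cases hqp : q = p
    · subst hqp
      exact hp hq b
    · refine mem_primeSaturation_of_nsmul_mem (n := (q : ℕ) ^ r q) ?_ ?_
      · exact Nat.Coprime.pow_left _ ((Nat.coprime_primes q.2 p.2).2 fun h => hqp (Subtype.ext h))
      · rw [nsmul_inv_pow_smul]
        exact hB _

theorem zassenhausGroup_le_of_not_invertibleAt {p : Nat.Primes} (hp : ¬ InvertibleAt a c p) :
    zassenhausGroup a c r ≤ primeSaturation p (toQ A).range.toAddSubgroup :=
  zassenhausGroup_le_primeSaturation (fun b => le_primeSaturation _ _ ⟨b, rfl⟩)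
    fun h => absurd h hp

theorem exists_nsmul_eq_toQ_mul_of_invertibleAt (hadm : AdmissibleExponents a c r)
    {p : Nat.Primes} (hp : InvertibleAt a c p) {v : ℚ ⊗[ℤ] A} (hv : v ∈ zassenhausGroup a c r) :
    ∃ k : ℕ, k.Coprime p ∧ ∃ w : A,
      k • (((p : ℕ) ^ r p) • v) = toQ A (((c p : A) - a p) * w) := by
  -- `B` consists of the `v` with `p^r v ∈ (c_p - a_p) A`. Admissibility places `A` in it up to the
  -- factor `d` prime to `p`.
  set B : AddSubgroup (ℚ ⊗[ℤ] A) :=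
    ((toQ A).toAddMonoidHom.comp (AddMonoidHom.mulLeft ((c p : A) - a p))).range.comap
      (nsmulAddMonoidHom ((p : ℕ) ^ r p)) with hB
  have hmem : ∀ v, v ∈ B ↔ ∃ w : A, toQ A (((c p : A) - a p) * w) = ((p : ℕ) ^ r p) • v :=
    fun v => Iff.rfl
  have hle : zassenhausGroup a c r ≤ primeSaturation p B := by
    refine zassenhausGroup_le_primeSaturation (fun b => ?_) fun _ b => ?_
    · obtain ⟨-, d, -, hd, t, ht⟩ := hadm p hp
      refine ⟨d, hd, (hmem _).2 ⟨t * b, ?_⟩⟩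
      have ht : toQ A t = _ := ht
      rw [map_mul, map_mul, ht, smul_mul_assoc, mul_smul_comm, ← mul_assoc,
        Ring.mul_inverse_cancel _ hp, one_mul, mul_smul, ← Nat.cast_smul_eq_nsmul ℚ,
        ← Nat.cast_smul_eq_nsmul ℚ, Nat.cast_pow]
    · refine le_primeSaturation _ _ ((hmem _).2 ⟨b, ?_⟩)
      rw [nsmul_inv_pow_smul]
  obtain ⟨k, hk, hkv⟩ := hle hv
  obtain ⟨w, hw⟩ := (hmem _).1 hkv
  exact ⟨k, hk, w, by rw [hw, smul_comm]⟩

/-- An endomorphism of the group that is right multiplication by `z ∈ ℚA` has `z ∈ A`. -/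
theorem mem_range_toQ_of_mul_mem (hadm : AdmissibleExponents a c r) (z : ℚ ⊗[ℤ] A)
    (hz : ∀ v ∈ zassenhausGroup a c r, v * z ∈ zassenhausGroup a c r) : z ∈ (toQ A).range := by
  refine mem_of_forall_mem_primeSaturation (B := (toQ A).range.toAddSubgroup) fun p => ?_
  by_cases hp : InvertibleAt a c p
  · obtain ⟨k, hk, w, hw⟩ := exists_nsmul_eq_toQ_mul_of_invertibleAt hadm hp
      (hz _ (inv_pow_smul_mem_zassenhausGroup hp 1))
    -- This reads `(c_p - a_p) (k z) = (c_p - a_p) w`, where the unit cancels.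
    rw [← smul_mul_assoc, nsmul_inv_pow_smul, mul_one, map_mul, ← mul_smul_comm] at hw
    have h1 : k • z = toQ A w := hp.mul_left_cancel hw
    exact ⟨k, hk, w, h1.symm⟩
  · have h1 := hz _ (toQ_mem_zassenhausGroup 1)
    rw [map_one, one_mul] at h1
    exact zassenhausGroup_le_of_not_invertibleAt hp h1

open Polynomial Filter in
theorem endomorphism_toQ_apply [Module.Free ℤ A] [Module.Finite ℤ A]
    (hadm : AdmissibleExponents a c r)
    (hfreq : ∀ x : A, x ≠ 0 → ∀ f : ℤ[X], 0 < f.natDegree →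
      ∃ᶠ p : Nat.Primes in cofinite, a p = x ∧ ((p : ℕ) : ℤ) ∣ f.eval (c p))
    (hc : ∀ p : Nat.Primes, ((p : ℕ) : ℤ) ≤ c p)
    (φ : AddMonoid.End (zassenhausGroup a c r)) (x : A) :
    (φ ⟨toQ A x, toQ_mem_zassenhausGroup x⟩ : ℚ ⊗[ℤ] A) =
      toQ A x * (φ ⟨toQ A 1, toQ_mem_zassenhausGroup 1⟩ : ℚ ⊗[ℤ] A) := by
  rcases eq_or_ne x 0 with rfl | hx
  · have h0 : (⟨toQ A 0, toQ_mem_zassenhausGroup 0⟩ : zassenhausGroup a c r) = 0 :=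
      Subtype.ext (map_zero _)
    rw [h0, map_zero, map_zero, zero_mul]; rfl
  by_contra hne
  set z : ℚ ⊗[ℤ] A := (φ ⟨toQ A 1, toQ_mem_zassenhausGroup 1⟩ : ℚ ⊗[ℤ] A) with hz
  set z' : ℚ ⊗[ℤ] A := (φ ⟨toQ A x, toQ_mem_zassenhausGroup x⟩ : ℚ ⊗[ℤ] A) with hz'
  obtain ⟨N₁, hN₁, s₁, hs₁⟩ := exists_nsmul_eq_toQ z
  obtain ⟨N₂, hN₂, s₂, hs₂⟩ := exists_nsmul_eq_toQ z'
  obtain ⟨N, hN, s, t, hs, ht⟩ : ∃ N : ℕ, N ≠ 0 ∧ ∃ s t : A, N • z = toQ A s ∧ N • z' = toQ A t :=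
    ⟨N₁ * N₂, (Nat.mul_pos hN₁ hN₂).ne', N₂ • s₁, N₁ • s₂,
      by rw [mul_comm, mul_smul, hs₁, map_nsmul], by rw [mul_smul, hs₂, map_nsmul]⟩
  have hy : x * s - t ≠ 0 := by
    intro h0
    apply hne
    refine nsmul_left_cancel_of_rat_module hN ?_
    rw [ht, ← mul_smul_comm, hs, ← map_mul, sub_eq_zero.1 h0]
  obtain ⟨f, hf, N₀, hN₀, hobs⟩ := exists_polynomial_obstruction x (x * s - t) hy
  obtain ⟨B, hB⟩ := exists_forall_isUnit_toQ_intCast_sub x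
  have hlarge : ∀ᶠ p : Nat.Primes in cofinite, B ≤ ((p : ℕ) : ℤ) ∧ N₀.natAbs < (p : ℕ) := by
    have h1 : Tendsto (fun p : Nat.Primes => (p : ℕ)) cofinite atTop := by
      rw [← Nat.cofinite_eq_atTop]
      exact Subtype.val_injective.tendsto_cofinite
    filter_upwards [h1.eventually (eventually_ge_atTop B.toNat),
      h1.eventually (eventually_gt_atTop N₀.natAbs)] with p h2 h3
    exact ⟨by omega, h3⟩
  obtain ⟨p, ⟨hap, hpf⟩, hpB, hpN⟩ := ((hfreq x hx f hf).and_eventually hlarge).exists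
  have hinv : InvertibleAt a c p := by
    unfold InvertibleAt
    rw [hap]
    exact hB _ (hpB.trans (hc p))
  set m : zassenhausGroup a c r := ⟨_, inv_pow_smul_mem_zassenhausGroup hinv 1⟩ with hm
  have hpm : ((p : ℕ) ^ r p) • m = c p • ⟨toQ A 1, toQ_mem_zassenhausGroup 1⟩ -
      ⟨toQ A x, toQ_mem_zassenhausGroup x⟩ := by
    apply Subtype.ext
    rw [AddSubgroup.coe_nsmul, hm, nsmul_inv_pow_smul, hap, AddSubgroup.coe_sub,
      AddSubgroup.coe_zsmul, mul_one, map_sub, ← map_zsmul, zsmul_one]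
  have hφm : ((p : ℕ) ^ r p) • (φ m : ℚ ⊗[ℤ] A) = c p • z - z' := by
    rw [← AddSubgroup.coe_nsmul, ← map_nsmul, hpm, map_sub, map_zsmul, AddSubgroup.coe_sub,
      AddSubgroup.coe_zsmul]
  obtain ⟨k, hk, w, hw⟩ := exists_nsmul_eq_toQ_mul_of_invertibleAt hadm hinv (φ m).2
  rw [hφm, hap] at hw
  have hA : k • (c p • s - t) = N • (((c p : A) - x) * w) := by
    apply toQ_injective A
    rw [map_nsmul, map_sub, map_zsmul, ← hs, ← ht, map_nsmul, ← hw, smul_comm (c p) N z,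
      ← smul_sub, smul_comm]
  -- Subtract `k (c_p - x) s`, using `c_p s - t = (c_p - x) s + (x s - t)`.
  have hky : (k : ℤ) • (x * s - t) = ((c p : A) - x) * (N • w - k • s) := by
    rw [mul_sub, mul_smul_comm, ← hA, mul_smul_comm, ← smul_sub, natCast_zsmul, sub_mul,
      zsmul_eq_mul]
    congr 1
    abel
  have hreg : ∀ v : A, ((c p : A) - x) * v = 0 → v = 0 := by
    intro v hv
    apply toQ_injective A
    have h1 : IsUnit (toQ A ((c p : A) - x)) := hB _ (hpB.trans (hc p))
    apply h1.mul_left_cancel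
    rw [← map_mul, hv, map_zero, mul_zero]
  -- `p` would divide `k N₀`, but `k` is prime to `p` and `0 < |N₀| < p`.
  have hdvd := hobs _ _ _ _ hreg hpf hky
  rcases (Nat.prime_iff_prime_int.1 p.2).dvd_or_dvd hdvd with h1 | h1
  · have h2 := Nat.dvd_gcd (Int.natCast_dvd_natCast.1 h1) dvd_rfl
    rw [show Nat.gcd k p = 1 from hk, Nat.dvd_one] at h2
    exact p.2.one_lt.ne' h2
  · exact absurd (Nat.le_of_dvd (Int.natAbs_pos.2 hN₀) (Int.natCast_dvd.1 h1)) hpN.not_ge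

variable (a c r) in
/-- Right multiplication of `A` on the group, as a ring homomorphism. -/
noncomputable def zassenhausRightMul : Aᵐᵒᵖ →+* AddMonoid.End (zassenhausGroup a c r) where
  toFun x :=
    { toFun := fun m => ⟨m * toQ A x.unop, zassenhausGroup_mul_mem m.2 _⟩
      map_zero' := Subtype.ext (zero_mul _)
      map_add' := fun m n => Subtype.ext (add_mul _ _ _) }
  map_one' := AddMonoidHom.ext fun m => Subtype.ext (by
    show (m : ℚ ⊗[ℤ] A) * toQ A 1 = m
    rw [map_one, mul_one])
  map_mul' x y := AddMonoidHom.ext fun m => Subtype.ext (by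
    show (m : ℚ ⊗[ℤ] A) * toQ A (y.unop * x.unop) = m * toQ A y.unop * toQ A x.unop
    rw [map_mul, mul_assoc])
  map_zero' := AddMonoidHom.ext fun m => Subtype.ext (by
    show (m : ℚ ⊗[ℤ] A) * toQ A 0 = 0
    rw [map_zero, mul_zero])
  map_add' x y := AddMonoidHom.ext fun m => Subtype.ext (by
    show (m : ℚ ⊗[ℤ] A) * toQ A (x.unop + y.unop) = m * toQ A x.unop + m * toQ A y.unop
    rw [map_add, mul_add])

open Polynomial Filter in
theorem endIsRightMul_zassenhausGroup [Module.Free ℤ A] [Module.Finite ℤ A]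
    (hadm : AdmissibleExponents a c r)
    (hfreq : ∀ x : A, x ≠ 0 → ∀ f : ℤ[X], 0 < f.natDegree →
      ∃ᶠ p : Nat.Primes in cofinite, a p = x ∧ ((p : ℕ) : ℤ) ∣ f.eval (c p))
    (hc : ∀ p : Nat.Primes, ((p : ℕ) : ℤ) ≤ c p) :
    EndIsRightMul (zassenhausGroup a c r) := by
  refine ⟨RingEquiv.ofBijective (zassenhausRightMul a c r) ⟨fun x y hxy => ?_, fun φ => ?_⟩,
    fun x m => rfl⟩
  · have h0 := DFunLike.congr_fun hxy
      (⟨toQ A 1, toQ_mem_zassenhausGroup 1⟩ : zassenhausGroup a c r)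
    have h1 : toQ A 1 * toQ A x.unop = toQ A 1 * toQ A y.unop := congrArg Subtype.val h0
    rw [map_one, one_mul, one_mul] at h1
    exact MulOpposite.unop_injective (toQ_injective A h1)
  · have hmul : ∀ m : zassenhausGroup a c r, (φ m : ℚ ⊗[ℤ] A) =
        m * (φ ⟨toQ A 1, toQ_mem_zassenhausGroup 1⟩ : ℚ ⊗[ℤ] A) := by
      intro m
      obtain ⟨N, hN, s, hs⟩ := exists_nsmul_eq_toQ (m : ℚ ⊗[ℤ] A)
      refine nsmul_left_cancel_of_rat_module hN.ne' ?_
      rw [← smul_mul_assoc, hs, ← endomorphism_toQ_apply hadm hfreq hc φ s,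
        ← AddSubgroup.coe_nsmul, ← map_nsmul]
      congr 2
      exact Subtype.ext hs
    obtain ⟨x, hx⟩ := mem_range_toQ_of_mul_mem hadm
      (φ ⟨toQ A 1, toQ_mem_zassenhausGroup 1⟩ : ℚ ⊗[ℤ] A)
      (fun v hv => hmul ⟨v, hv⟩ ▸ (φ ⟨v, hv⟩).2)
    refine ⟨MulOpposite.op x, AddMonoidHom.ext fun m => Subtype.ext ?_⟩
    refine Eq.trans ?_ (hmul m).symm
    rw [← hx]
    rfl

end Zassenhaus

theorem theorem4p4 {A : Type*} [Ring A] [Module.Free ℤ A] [Module.Finite ℤ A]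
    [MeasurableSpace A] [DiscreteMeasurableSpace A]
    {Ω : Type*} [MeasurableSpace Ω] (μ : Measure Ω) [IsProbabilityMeasure μ]
    (a : Nat.Primes → Ω → A) (c : Nat.Primes → Ω → ℤ)
    (h : ZassenhausDistribution μ a c) :
    ∀ᵐ ω ∂μ, ∀ r : Nat.Primes → ℕ,
      AdmissibleExponents (fun p => a p ω) (fun p => c p ω) r →
        EndIsRightMul (zassenhausGroup (fun p => a p ω) (fun p => c p ω) r) := by
  have : Countable A := (Module.Free.chooseBasis ℤ A).equivFun.toEquiv.injective.countable
  filter_upwards [h.ae_forall_frequently_dvd_eval, h.ae_le_c] with ω hω hc r hadm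
  exact endIsRightMul_zassenhausGroup hadm hω hc
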